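/- Let $G$ be a finite simple graph; write $\alpha(G)$ for its independence number and $\Delta(G)$, $\delta(G)$ for its maximum and minimum degree. Call $G$ 2-connected if it has at least two vertices and $G-S$ is connected for every set $S$ of at most one vertex. If $G$ is connected with $\alpha(G)\le 3$ and $\Delta(G)-\delta(G)\le 1$, or if $G$ is a 2-connected regular graph with $\alpha(G)\le 4$, then $G$ has a spanning path, that is, a path containing every vertex of $G$. -/

import Mathlib

/-- `G` is `k`-connected: it has at least `k` vertices, and deleting any set of fewer than `k`
vertices leaves a connected graph. -/
def SimpleGraph.IsKVertexConnected {V : Type*} [Fintype V] (G : SimpleGraph V) (k : ℕ) : Prop :=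
  k ≤ Fintype.card V ∧
    ∀ S : Finset V, S.card < k → (G.induce ((S : Set V)ᶜ)).Connected

/-- `G` has a spanning path: a path that visits every vertex exactly once. -/
def SimpleGraph.HasSpanningPath {V : Type*} [DecidableEq V] (G : SimpleGraph V) : Prop :=
  ∃ (x y : V) (p : G.Walk x y), p.IsHamiltonian

/-! ### Vertex lists of walks -/

namespace SimpleGraph

/-! Suppose a longest path `P` misses a vertex, and let `H` be a component of `G - P` (a gap). By
the usual exchange arguments, a vertex of `H`, the head of `P`, and the successors on `P` of the
neighbours of `H` are independent. So `H` has exactly one neighbour on `P` when `α ≤ 3`, and exactly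
two when `α ≤ 4` and `G` is 2-connected. A further nonadjacent pair inside `H` would enlarge the
independent set, so `H` is a clique, and the degree condition fixes its order.

With `α ≤ 3` and minimum degree `d`, `H` has `d + 1` vertices and `P = A u B`. Replacing `A` or `B`
by `H` shows that each has at least `d + 1` vertices, while covering `V` by closed neighbourhoods of
independent vertices gives `|A| + |B| ≤ 2d + 3`. So one side has exactly `d + 1` vertices. Swapping
it with `H` yields a second longest path whose gap also hangs at `u`; `u` is then adjacent to the
whole other side and has too large a degree (`IsPendantGap.length_ne`).

With `α ≤ 4` and `G` `d`-regular, `H` has `d` vertices, `P = A u B v C`, each segment has at least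
`d` vertices, and together they have at most `3d + 1`. If `|B| = d`, swap `B` with `H`; otherwise
`|A| = d`, and swap `A` with `H`. Either way two disjoint gaps of order `d` have all their vertices
adjacent to `u` or `v`. These vertices use up all `2d` edge ends available at `u` and `v`, yet `u`
has one more neighbour (`false_of_adj_or_adj`). -/

/-- `l` lists the vertices of a walk of `G` from `a` to `b`. -/
structure IsRoute {V : Type*} (G : SimpleGraph V) (l : List V) (a b : V) : Prop where
  isChain : l.IsChain G.Adj
  head : l.head? = some a
  last : l.getLast? = some b

namespace IsRoute

variable {V : Type*} {G : SimpleGraph V} {l m : List V} {a b c d : V}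

theorem singleton (a : V) : G.IsRoute [a] a a := ⟨by simp, rfl, rfl⟩

theorem ne_nil (h : G.IsRoute l a b) : l ≠ [] := by
  rintro rfl
  simpa using h.head

theorem append (h : G.IsRoute l a b) (hbc : G.Adj b c) (h' : G.IsRoute m c d) :
    G.IsRoute (l ++ m) a d := by
  refine ⟨List.isChain_append.2 ⟨h.isChain, h'.isChain, ?_⟩, ?_, ?_⟩
  · rw [h.last, h'.head]
    rintro x ⟨⟩ y ⟨⟩
    exact hbc
  · simp [List.head?_append, h.head]
  · simp [List.getLast?_append, h'.last]

theorem cons (hab : G.Adj a b) (h : G.IsRoute l b c) : G.IsRoute (a :: l) a c :=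
  (singleton a).append hab h

theorem reverse (h : G.IsRoute l a b) : G.IsRoute l.reverse b a := by
  refine ⟨?_, by simp [h.last], by simp [h.head]⟩
  rw [List.isChain_reverse]
  exact h.isChain.imp fun _ _ hab => hab.symm

theorem head_mem (h : G.IsRoute l a b) : a ∈ l := List.mem_of_head? h.head

theorem last_mem (h : G.IsRoute l a b) : b ∈ l := List.mem_of_getLast? h.last

theorem length_pos (h : G.IsRoute l a b) : 0 < l.length := List.length_pos_of_mem h.head_mem

theorem exists_of_isChain (h : l.IsChain G.Adj) (hl : l ≠ []) : ∃ a b, G.IsRoute l a b :=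
  ⟨l.head hl, l.getLast hl, h, List.head?_eq_some_head hl, List.getLast?_eq_some_getLast hl⟩

theorem exists_of_split {u : V} (h : (l ++ u :: m).IsChain G.Adj) (hl : l ≠ []) (hm : m ≠ []) :
    ∃ a b c d, G.IsRoute l a b ∧ G.Adj b u ∧ G.Adj u c ∧ G.IsRoute m c d := by
  obtain ⟨h₁, h₂, h₃⟩ := List.isChain_append.1 h
  obtain ⟨h₄, h₅⟩ := List.isChain_cons.1 h₂
  obtain ⟨a, b, hab⟩ := exists_of_isChain h₁ hl
  obtain ⟨c, d, hcd⟩ := exists_of_isChain h₅ hm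
  exact ⟨a, b, c, d, hab, h₃ b hab.last u rfl, h₄ c hcd.head, hcd⟩

theorem exists_of_walk (p : G.Walk a b) (hp : p.IsPath) :
    ∃ l, G.IsRoute l a b ∧ l.Nodup ∧ ∀ x ∈ l, G.Reachable a x := by
  classical
  refine ⟨p.support, ⟨p.isChain_adj_support, ?_, ?_⟩, hp.support_nodup, fun x hx =>
    ⟨p.takeUntil x hx⟩⟩
  · rw [List.head?_eq_some_head p.support_ne_nil]; simp
  · rw [List.getLast?_eq_some_getLast p.support_ne_nil]; simp

theorem mono {G' : SimpleGraph V} (hle : G ≤ G') (h : G.IsRoute l a b) : G'.IsRoute l a b :=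
  ⟨h.isChain.imp fun _ _ hab => hle hab, h.head, h.last⟩

end IsRoute

/-! ### Routes through cliques, and independent lists -/

theorem exists_route_of_isClique {V : Type*} [DecidableEq V] {G : SimpleGraph V} (n : ℕ) :
    ∀ (H : Finset V) (a b : V), H.card = n → G.IsClique (H : Set V) → a ∈ H → b ∈ H → a ≠ b →
    ∃ l, G.IsRoute l a b ∧ l.Nodup ∧ ∀ x, x ∈ l ↔ x ∈ H := by
  induction n with
  | zero =>
    intro H a b h0 _ ha
    simp [Finset.card_eq_zero.1 h0] at ha
  | succ n ih =>
    intro H a b hn hH ha hb hab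
    have hK : G.IsClique ((H.erase a : Finset V) : Set V) :=
      hH.subset (by simp)
    by_cases hc : ∃ c ∈ H, c ≠ a ∧ c ≠ b
    · obtain ⟨c, hc, hca, hcb⟩ := hc
      obtain ⟨l, hl, hnd, hmem⟩ := ih (H.erase a) c b (by rw [Finset.card_erase_of_mem ha]; omega)
        hK (by simp [*]) (by simp [*, hab.symm]) hcb
      refine ⟨a :: l, hl.cons (hH ha hc hca.symm), ?_, ?_⟩
      · simp [hnd, hmem]
      · intro x
        by_cases hx : x = a <;> simp [hx, hmem, ha]
    · push Not at hc
      refine ⟨[a, b], (IsRoute.singleton b).cons (hH ha hb hab), by simp [hab], ?_⟩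
      intro x
      simp only [List.mem_cons, List.not_mem_nil, or_false]
      constructor
      · rintro (rfl | rfl) <;> assumption
      · intro hx
        by_contra! hxx
        exact hxx.2 (hc x hx hxx.1)

theorem exists_route_of_isClique_of_mem {V : Type*} [DecidableEq V] {G : SimpleGraph V}
    {H : Finset V} {a : V} (hH : G.IsClique (H : Set V)) (ha : a ∈ H) :
    ∃ l b, G.IsRoute l a b ∧ l.Nodup ∧ ∀ x, x ∈ l ↔ x ∈ H := by
  by_cases hb : ∃ b ∈ H, a ≠ b
  · obtain ⟨b, hb, hab⟩ := hb
    obtain ⟨l, hl⟩ := exists_route_of_isClique _ H a b rfl hH ha hb hab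
    exact ⟨l, b, hl⟩
  · push Not at hb
    refine ⟨[a], a, IsRoute.singleton a, by simp, fun x => ?_⟩
    simp only [List.mem_singleton]
    exact ⟨fun h => h ▸ ha, fun h => (hb x h).symm⟩

theorem length_eq_card_of_mem_iff {V : Type*} [DecidableEq V] {l : List V} {H : Finset V}
    (hl : l.Nodup) (h : ∀ x, x ∈ l ↔ x ∈ H) : l.length = H.card := by
  rw [← List.toFinset_card_of_nodup hl]
  congr 1
  ext x
  simp [h]

theorem length_le_indepNum {V : Type*} [Fintype V] [DecidableEq V] {G : SimpleGraph V} (l : List V)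
    (h : l.Pairwise fun a b => a ≠ b ∧ ¬ G.Adj a b) : l.length ≤ G.indepNum := by
  have hnd : l.Nodup := h.imp fun h => h.1
  rw [← List.toFinset_card_of_nodup hnd]
  refine IsIndepSet.card_le_indepNum (t := l.toFinset) ?_
  intro a ha b hb hab
  have : Std.Symm fun a b : V => a ≠ b ∧ ¬ G.Adj a b :=
    ⟨fun x y hxy => ⟨hxy.1.symm, fun h => hxy.2 h.symm⟩⟩
  exact (h.forall (by simpa using ha) (by simpa using hb) hab).2

/-! ### Longest paths and gaps -/

/-- `P` lists the vertices of a longest path of `G`. -/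
structure IsLongest {V : Type*} (G : SimpleGraph V) (P : List V) : Prop where
  nodup : P.Nodup
  isChain : P.IsChain G.Adj
  length_le : ∀ Q : List V, Q.Nodup → Q.IsChain G.Adj → Q.length ≤ P.length

/-- `H` is the vertex set of a connected component of the graph left by deleting `P`. -/
structure IsGap {V : Type*} (G : SimpleGraph V) (P : List V) (H : Finset V) : Prop where
  nonempty : H.Nonempty
  notMem : ∀ h ∈ H, h ∉ P
  closed : ∀ h ∈ H, ∀ w, G.Adj h w → w ∈ H ∨ w ∈ P
  joined : ∀ h ∈ H, ∀ h' ∈ H, ∃ L, G.IsRoute L h h' ∧ L.Nodup ∧ ∀ x ∈ L, x ∈ H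

section

variable {V : Type*} {G : SimpleGraph V} {P : List V} {H : Finset V}

theorem exists_isLongest [Fintype V] (G : SimpleGraph V) : ∃ P, G.IsLongest P := by
  classical
  let S : Set ℕ := {n | ∃ Q : List V, Q.Nodup ∧ Q.IsChain G.Adj ∧ Q.length = n}
  have hne : S.Nonempty := ⟨0, [], by simp⟩
  have hbd : BddAbove S := ⟨Fintype.card V, by
    rintro n ⟨Q, hQ, -, rfl⟩
    exact hQ.length_le_card⟩
  obtain ⟨P, h₁, h₂, h₃⟩ := Nat.sSup_mem hne hbd
  exact ⟨P, h₁, h₂, fun Q h h' => h₃ ▸ le_csSup hbd ⟨Q, h, h', rfl⟩⟩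

theorem hasSpanningPath_of_list [DecidableEq V] [Nonempty V] (hP : P.Nodup)
    (hc : P.IsChain G.Adj) (hall : ∀ x, x ∈ P) : G.HasSpanningPath := by
  have hne : P ≠ [] := List.ne_nil_of_mem (hall (Classical.arbitrary V))
  refine ⟨_, _, Walk.ofSupport P hne hc, fun x => ?_⟩
  rw [Walk.support_ofSupport]
  exact List.count_eq_one_of_mem hP (hall x)

theorem exists_isGap [Fintype V] (G : SimpleGraph V) {z : V} (hz : z ∉ P) :
    ∃ H, z ∈ H ∧ G.IsGap P H := by
  classical
  -- Deleting the edges that meet `P`, not its vertices, keeps the vertex type; the gap is the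
  -- reachability class of `z`.
  let G' : SimpleGraph V :=
    { Adj := fun a b => G.Adj a b ∧ a ∉ P ∧ b ∉ P
      symm := ⟨fun a b h => ⟨h.1.symm, h.2.2, h.2.1⟩⟩
      loopless := ⟨fun a h => G.loopless.1 a h.1⟩ }
  have hle : G' ≤ G := fun a b h => h.1
  have hnot : ∀ a, G'.Reachable z a → a ∉ P := by
    intro a ha
    induction (reachable_iff_reflTransGen z a).1 ha with
    | refl => exact hz
    | tail _ h _ => exact h.2.2
  refine ⟨Finset.univ.filter fun a => G'.Reachable z a, by simp, ⟨z, by simp⟩, ?_, ?_, ?_⟩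
  · intro h hh
    exact hnot h (by simpa using hh)
  · intro h hh w hw
    by_cases hwP : w ∈ P
    · exact Or.inr hwP
    · left
      simp only [Finset.mem_filter, Finset.mem_univ, true_and] at hh ⊢
      exact hh.trans (Adj.reachable (G := G') ⟨hw, hnot h hh, hwP⟩)
  · intro h hh h' hh'
    simp only [Finset.mem_filter, Finset.mem_univ, true_and] at hh hh' ⊢
    obtain ⟨p, hp⟩ := (hh.symm.trans hh').exists_isPath
    obtain ⟨l, hl, hnd, hr⟩ := IsRoute.exists_of_walk p hp
    exact ⟨l, hl.mono hle, hnd, fun x hx => hh.trans (hr x hx)⟩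

theorem mem_of_reachable_of_closed {x y : V} (S : Set V) (hS : ∀ a ∈ S, ∀ b, G.Adj a b → b ∈ S)
    (hx : x ∈ S) (h : G.Reachable x y) : y ∈ S := by
  induction (reachable_iff_reflTransGen x y).1 h with
  | refl => exact hx
  | tail hb hadj ih => exact hS _ (ih ((reachable_iff_reflTransGen _ _).2 hb)) _ hadj

/-! ### Exchange arguments -/

namespace IsLongest

theorem reverse (hP : G.IsLongest P) : G.IsLongest P.reverse :=
  ⟨List.nodup_reverse.2 hP.nodup, List.isChain_reverse.2
    (hP.isChain.imp fun _ _ h => h.symm), by simpa using hP.length_le⟩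

theorem ne_nil (hP : G.IsLongest P) {z : V} (hz : z ∉ P) : P ≠ [] := by
  rintro rfl
  simpa using hP.length_le [z] (by simp) (by simp)

variable [DecidableEq V]

/-- The form in which every exchange is made: `Q` rearranges pieces of `P` and of a detour `L`
outside `P`. Comparing multiplicities shows that `Q` has no repetition, and leaves only arithmetic
of counts to check. -/
theorem length_le_of_count_le (hP : G.IsLongest P) {L Q : List V} (hL : L.Nodup)
    (hLP : ∀ x ∈ L, x ∉ P) (hQ : Q.IsChain G.Adj)
    (hc : ∀ x, Q.count x ≤ P.count x + L.count x) : Q.length ≤ P.length := by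
  refine hP.length_le Q (List.nodup_iff_count_le_one.2 fun x => (hc x).trans ?_) hQ
  have h₁ := List.nodup_iff_count_le_one.1 hP.nodup x
  have h₂ := List.nodup_iff_count_le_one.1 hL x
  by_cases hx : x ∈ L
  · have := List.count_eq_zero_of_not_mem (hLP x hx)
    omega
  · have := List.count_eq_zero_of_not_mem hx
    omega

theorem of_count_le (hP : G.IsLongest P) {L Q : List V} (hL : L.Nodup)
    (hLP : ∀ x ∈ L, x ∉ P) (hQ : Q.IsChain G.Adj)
    (hc : ∀ x, Q.count x ≤ P.count x + L.count x) (hlen : P.length ≤ Q.length) :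
    G.IsLongest Q := by
  refine ⟨List.nodup_iff_count_le_one.2 fun x => (hc x).trans ?_, hQ,
    fun R h h' => (hP.length_le R h h').trans hlen⟩
  have h₁ := List.nodup_iff_count_le_one.1 hP.nodup x
  have h₂ := List.nodup_iff_count_le_one.1 hL x
  by_cases hx : x ∈ L
  · have := List.count_eq_zero_of_not_mem (hLP x hx)
    omega
  · have := List.count_eq_zero_of_not_mem hx
    omega

theorem not_adj_head (hP : G.IsLongest P) {z a b : V} (hz : z ∉ P) (h : G.IsRoute P a b) :
    ¬ G.Adj z a := by
  intro hza
  have := hP.length_le_of_count_le (L := [z]) (Q := z :: P) (by simp) (by simpa using hz)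
    (h.cons hza).isChain (fun x => by simp [List.count_cons])
  simp at this

/-- A neighbour of an outside vertex is an inner vertex of a longest path. -/
theorem ne_nil_of_adj (hP : G.IsLongest P) {A B : List V} {u z : V} (hz : z ∉ P)
    (hAB : P = A ++ u :: B) (hu : G.Adj z u) : A ≠ [] ∧ B ≠ [] := by
  obtain ⟨a, b, hab⟩ := IsRoute.exists_of_isChain hP.isChain (hP.ne_nil hz)
  constructor
  · rintro rfl
    have := hab.head
    simp only [hAB, List.nil_append, List.head?_cons, Option.some.injEq] at this
    exact hP.not_adj_head hz hab (this ▸ hu)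
  · rintro rfl
    have := hab.last
    simp only [hAB, List.getLast?_append, List.getLast?_singleton, Option.some_or,
      Option.some.injEq] at this
    exact hP.reverse.not_adj_head (by simpa using hz) hab.reverse (this ▸ hu)

/-- The first vertex of a longest path is not adjacent to the successor of a neighbour of an
outside vertex. -/
theorem not_adj_head_succ (hP : G.IsLongest P) {A B : List V} {u z a a' b b' : V} (hz : z ∉ P)
    (hAB : P = A ++ u :: B) (hu : G.Adj z u) (hA : G.IsRoute A a a') (hau : G.Adj a' u)
    (hB : G.IsRoute B b b') : ¬ G.Adj a b := by
  intro hab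
  -- Start at `z`, go to `u`, run back through `A` to its head, and jump to `B`.
  have := hP.length_le_of_count_le (L := [z]) (Q := z :: u :: (A.reverse ++ B)) (by simp)
    (by simpa using hz) ((((hA.reverse.append hab hB).cons hau.symm).cons hu).isChain)
    (fun x => by simp [hAB, List.count_cons]; omega)
  simp [hAB] at this
  omega

end IsLongest

namespace IsGap

theorem not_adj_of_notMem (hH : G.IsGap P H) {h w : V} (hh : h ∈ H) (hw : w ∉ H) (hwP : w ∉ P) :
    ¬ G.Adj h w := fun hadj => (hH.closed h hh w hadj).elim hw hwP

theorem ne_of_mem (hH : G.IsGap P H) {h w : V} (hh : h ∈ H) (hw : w ∈ P) : h ≠ w := by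
  rintro rfl
  exact hH.notMem h hh hw

theorem reverse (hH : G.IsGap P H) : G.IsGap P.reverse H :=
  ⟨hH.nonempty, by simpa using hH.notMem, by simpa using hH.closed, hH.joined⟩

variable [DecidableEq V]

/-- The successor of a neighbour of a gap has no neighbour in the gap. -/
theorem not_adj_succ (hH : G.IsGap P H) (hP : G.IsLongest P) {A B : List V} {u b b' z h : V}
    (hAB : P = A ++ u :: B) (hz : z ∈ H) (hu : G.Adj z u) (hB : G.IsRoute B b b') (hh : h ∈ H) :
    ¬ G.Adj h b := by
  intro hhb
  obtain ⟨hA, hB'⟩ := hP.ne_nil_of_adj (hH.notMem z hz) hAB hu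
  obtain ⟨a, a', _, _, hA, hau, -⟩ := IsRoute.exists_of_split (hAB ▸ hP.isChain) hA hB'
  obtain ⟨L, hL, hnd, hLH⟩ := hH.joined z hz h hh
  have := hP.length_le_of_count_le (L := L) (Q := A ++ ([u] ++ (L ++ B))) hnd
    (fun x hx => hH.notMem x (hLH x hx))
    (hA.append hau ((IsRoute.singleton u).append hu.symm (hL.append hhb hB))).isChain
    (fun x => by simp [hAB, List.count_cons]; omega)
  simp only [hAB, List.length_append, List.length_cons, List.length_nil] at this
  have := hL.length_pos
  omega

theorem ne_nil_of_adj (hH : G.IsGap P H) (hP : G.IsLongest P) {A B C : List V} {u v z h : V}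
    (hABC : P = A ++ u :: (B ++ v :: C)) (hz : z ∈ H) (hu : G.Adj z u) (hh : h ∈ H)
    (hv : G.Adj h v) : B ≠ [] := by
  rintro rfl
  obtain ⟨hA, hB'⟩ := hP.ne_nil_of_adj (hH.notMem z hz) hABC hu
  obtain ⟨_, _, c, c', -, -, -, hC⟩ := IsRoute.exists_of_split (hABC ▸ hP.isChain) hA hB'
  have := hC.head
  simp only [List.nil_append, List.head?_cons, Option.some.injEq] at this
  exact hH.not_adj_succ hP hABC hz hu hC hh (this ▸ hv)

/-- The successors of two neighbours of a gap are not adjacent. -/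
theorem not_adj_succ_succ (hH : G.IsGap P H) (hP : G.IsLongest P) {A B C : List V}
    {u v z h a a' b b' c c' : V}
    (hABC : P = A ++ u :: (B ++ v :: C)) (hz : z ∈ H) (hu : G.Adj z u) (hh : h ∈ H)
    (hv : G.Adj h v) (hA : G.IsRoute A a a') (hau : G.Adj a' u)
    (hB : G.IsRoute B b b') (hbv : G.Adj b' v) (hC : G.IsRoute C c c') : ¬ G.Adj b c := by
  intro hbc
  obtain ⟨L, hL, hnd, hLH⟩ := hH.joined z hz h hh
  -- Cross the gap from `u` to `v`, traverse `B` backwards, and use the edge `bc` to enter `C`.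
  have := hP.length_le_of_count_le (L := L)
    (Q := A ++ ([u] ++ (L ++ ([v] ++ (B.reverse ++ C))))) hnd
    (fun x hx => hH.notMem x (hLH x hx))
    (hA.append hau ((IsRoute.singleton u).append hu.symm (hL.append hv
      ((IsRoute.singleton v).append hbv.symm (hB.reverse.append hbc hC))))).isChain
    (fun x => by simp [hABC, List.count_cons]; omega)
  simp only [hABC, List.length_append, List.length_cons, List.length_nil,
    List.length_reverse] at this
  have := hL.length_pos
  omega

end IsGap

end

/-! ### Connected graphs with `α ≤ 3` -/

section

variable {V : Type*} {G : SimpleGraph V} {P : List V} {H : Finset V}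

/-- A common vertex would be adjacent to `z` within the clique, but a gap has no edge to a vertex
outside both itself and `P`. -/
theorem IsGap.disjoint_of_isClique {H' : Finset V} (hH : G.IsGap P H) (hH' : G.IsGap P H')
    (hK : G.IsClique (H' : Set V)) {z : V} (hz : z ∈ H') (hzH : z ∉ H) : Disjoint H H' := by
  rw [Finset.disjoint_left]
  intro w hw hw'
  exact hH.not_adj_of_notMem hw hzH (hH'.notMem z hz)
    (hK hw' hz fun h => hzH (h ▸ hw))

theorem IsGap.exists_adj (hG : G.Connected) (hH : G.IsGap P H) (hP : P ≠ []) :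
    ∃ h ∈ H, ∃ u ∈ P, G.Adj h u := by
  by_contra! hcon
  obtain ⟨h, hh⟩ := hH.nonempty
  obtain ⟨x, hx⟩ := List.exists_mem_of_ne_nil P hP
  have hxH : x ∈ (H : Set V) := mem_of_reachable_of_closed (G := G) (H : Set V)
    (fun a ha b hab => (hH.closed a ha b hab).elim id fun hb => (hcon a ha b hb hab).elim)
    hh (hG.preconnected h x)
  exact hH.notMem x hxH hx

/-- A clique component `H` of the complement of the longest path `A ++ u :: B`, attached to `u`
only, with `d + 1` vertices. -/
structure IsPendantGap (G : SimpleGraph V) (d : ℕ) (H : Finset V) (A : List V) (u : V)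
    (B : List V) : Prop where
  longest : G.IsLongest (A ++ u :: B)
  gap : G.IsGap (A ++ u :: B) H
  isClique : G.IsClique (H : Set V)
  card_eq : H.card = d + 1
  nbr : ∀ h ∈ H, ∀ w, G.Adj h w → w ∈ H ∨ w = u
  exists_adj : ∃ z ∈ H, G.Adj z u
  exists_not_adj : ∃ z ∈ H, ¬ G.Adj z u
  one_le : 1 ≤ d
  le_left : d + 1 ≤ A.length
  le_right : d + 1 ≤ B.length
  le_add : A.length + B.length ≤ 2 * d + 3

theorem IsPendantGap.reverse {d : ℕ} {A B : List V} {u : V} (h : G.IsPendantGap d H A u B) :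
    G.IsPendantGap d H B.reverse u A.reverse := by
  have hr : B.reverse ++ u :: A.reverse = (A ++ u :: B).reverse := by simp
  exact ⟨hr ▸ h.longest.reverse, hr ▸ h.gap.reverse, h.isClique, h.card_eq, h.nbr, h.exists_adj,
    h.exists_not_adj, h.one_le, by simpa using h.le_right, by simpa using h.le_left, by
    have := h.le_add
    simp only [List.length_reverse]
    omega⟩

variable [Fintype V] [DecidableEq V]

theorem IsGap.card_add_length_le (hH : G.IsGap P H) (hP : P.Nodup) :
    H.card + P.length ≤ Fintype.card V := by
  rw [← List.toFinset_card_of_nodup hP, ← Finset.card_union_of_disjoint]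
  · exact Finset.card_le_univ _
  · rw [Finset.disjoint_left]
    intro x hx
    simpa using hH.notMem x hx

theorem IsGap.card_add_card_add_length_le {H' : Finset V} (hH : G.IsGap P H) (hH' : G.IsGap P H')
    (hd : Disjoint H H') (hP : P.Nodup) : H.card + H'.card + P.length ≤ Fintype.card V := by
  rw [← List.toFinset_card_of_nodup hP, ← Finset.card_union_of_disjoint hd,
    ← Finset.card_union_of_disjoint]
  · exact Finset.card_le_univ _
  · rw [Finset.disjoint_left]
    intro x hx
    rcases Finset.mem_union.1 hx with hx | hx
    · simpa using hH.notMem x hx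
    · simpa using hH'.notMem x hx

/-- A gap with two neighbours on a longest path yields an independent set of four vertices,
consisting of one vertex of the gap, the head of the path and two successors. -/
theorem IsGap.four_le_indepNum (hH : G.IsGap P H) (hP : G.IsLongest P) {A B C : List V}
    {u v z h : V} (hABC : P = A ++ u :: (B ++ v :: C)) (hz : z ∈ H) (hu : G.Adj z u)
    (hh : h ∈ H) (hv : G.Adj h v) : 4 ≤ G.indepNum := by
  have hABC' : P = (A ++ u :: B) ++ v :: C := by simp [hABC]
  have hA := (hP.ne_nil_of_adj (hH.notMem z hz) hABC hu).1
  have hB := hH.ne_nil_of_adj hP hABC hz hu hh hv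
  have hC := (hP.ne_nil_of_adj (hH.notMem h hh) hABC' hv).2
  have hchain := hP.isChain
  rw [hABC] at hchain
  obtain ⟨a, a', b, c', hA, hau, hub, hBC⟩ := IsRoute.exists_of_split hchain hA (by simp)
  obtain ⟨b₁, b', c, c₁, hB, hbv, hvc, hC⟩ := IsRoute.exists_of_split hBC.isChain hB hC
  have hb : b = b₁ := by
    have := hBC.head
    rw [List.head?_append, hB.head] at this
    simpa using this.symm
  subst hb
  have hAB := hA.append hau (hB.cons hub)
  have hnd := hP.nodup
  have haP : a ∈ P := by simp [hABC, hA.head_mem]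
  have hbP : b ∈ P := by simp [hABC, hB.head_mem]
  have hcP : c ∈ P := by simp [hABC, hC.head_mem]
  have hne : a ≠ b ∧ a ≠ c ∧ b ≠ c := by
    rw [hABC] at hnd
    have := hA.head_mem
    have := hB.head_mem
    have := hC.head_mem
    simp only [List.nodup_append, List.nodup_cons, List.mem_append, List.mem_cons] at hnd
    grind
  refine length_le_indepNum [z, a, b, c] ?_
  simp only [List.pairwise_cons, List.mem_cons, List.not_mem_nil, or_false, forall_eq_or_imp,
    forall_eq, IsEmpty.forall_iff, implies_true, List.Pairwise.nil, and_true]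
  have hPac : G.IsRoute P a c₁ := hABC' ▸ hAB.append hbv (hC.cons hvc)
  exact ⟨⟨⟨hH.ne_of_mem hz haP, hP.not_adj_head (hH.notMem z hz) hPac⟩,
    ⟨hH.ne_of_mem hz hbP, hH.not_adj_succ hP hABC hz hu hBC hz⟩,
    ⟨hH.ne_of_mem hz hcP, hH.not_adj_succ hP hABC' hh hv hC hz⟩⟩,
    ⟨⟨hne.1, hP.not_adj_head_succ (hH.notMem z hz) hABC hu hA hau hBC⟩,
    ⟨hne.2.1, hP.not_adj_head_succ (hH.notMem h hh) hABC' hv hAB hbv hC⟩⟩,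
    ⟨hne.2.2, hH.not_adj_succ_succ hP hABC hz hu hh hv hA hau hB hbv hC⟩⟩

/-- A second attachment would give four independent vertices, so only `u` remains. With the head `a`
of `P` and the successor `b` of `u` independent and unattached to `H`, the bound on `α` makes `H` a
clique; degrees and exchanges give the numerical fields. -/
theorem IsGap.exists_isPendantGap [DecidableRel G.Adj] (hG : G.Connected) (hα : G.indepNum ≤ 3)
    {d : ℕ} (hd : ∀ v, d ≤ G.degree v) (hd' : ∀ v, G.degree v ≤ d + 1) (hP : G.IsLongest P)
    (hH : G.IsGap P H) : ∃ A u B, P = A ++ u :: B ∧ G.IsPendantGap d H A u B := by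
  obtain ⟨z, hz, u, huP, hu⟩ := hH.exists_adj hG (hP.ne_nil (hH.notMem _ hH.nonempty.choose_spec))
  obtain ⟨A, B, hAB⟩ := List.append_of_mem huP
  have huH : u ∉ H := fun h => hH.notMem u h huP
  obtain ⟨hA, hB⟩ := hP.ne_nil_of_adj (hH.notMem z hz) hAB hu
  obtain ⟨a, a', b, b', hA, hau, hub, hB⟩ := IsRoute.exists_of_split (hAB ▸ hP.isChain) hA hB
  have haP : a ∈ P := by simp [hAB, hA.head_mem]
  have hbP : b ∈ P := by simp [hAB, hB.head_mem]
  have hPr : G.IsRoute P a b' := hAB ▸ hA.append hau (hB.cons hub)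
  have hab : ¬ G.Adj a b := hP.not_adj_head_succ (hH.notMem z hz) hAB hu hA hau hB
  have hnd := hP.nodup
  rw [hAB] at hnd
  have hane : a ≠ b := by
    have := hA.head_mem
    have := hB.head_mem
    simp only [List.nodup_append, List.nodup_cons, List.mem_cons] at hnd
    grind
  have hna : ∀ h ∈ H, h ≠ a ∧ ¬ G.Adj h a := fun h hh =>
    ⟨hH.ne_of_mem hh haP, hP.not_adj_head (hH.notMem h hh) hPr⟩
  have hnb : ∀ h ∈ H, h ≠ b ∧ ¬ G.Adj h b := fun h hh =>
    ⟨hH.ne_of_mem hh hbP, hH.not_adj_succ hP hAB hz hu hB hh⟩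
  have hnbr : ∀ h ∈ H, ∀ w, G.Adj h w → w ∈ H ∨ w = u := by
    intro h hh w hw
    rcases hH.closed h hh w hw with hwH | hwP
    · exact Or.inl hwH
    right
    by_contra hwu
    have : w ∈ A ∨ w ∈ B := by
      rw [hAB] at hwP
      simpa [hwu] using hwP
    rcases this with hw' | hw'
    · obtain ⟨A₁, A₂, rfl⟩ := List.append_of_mem hw'
      have := hH.four_le_indepNum hP (A := A₁) (B := A₂) (C := B) (by simpa using hAB) hh hw hz hu
      omega
    · obtain ⟨B₁, B₂, rfl⟩ := List.append_of_mem hw'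
      have := hH.four_le_indepNum hP hAB hz hu hh hw
      omega
  have hK : ∀ {H' : Finset V}, (∀ h ∈ H', (h ≠ a ∧ ¬ G.Adj h a) ∧ (h ≠ b ∧ ¬ G.Adj h b)) →
      G.IsClique (H' : Set V) := by
    intro H' hH' h hh h' hh' hne
    by_contra hadj
    have := length_le_indepNum (G := G) [h, h', a, b] (by
      simp only [List.pairwise_cons, List.mem_cons, List.not_mem_nil, or_false, forall_eq_or_imp,
        forall_eq, IsEmpty.forall_iff, implies_true, List.Pairwise.nil, and_true]
      exact ⟨⟨⟨hne, hadj⟩, hH' h hh⟩, hH' h' hh', hane, hab⟩)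
    simp at this
    omega
  have hHK : G.IsClique (H : Set V) := hK fun h hh => ⟨hna h hh, hnb h hh⟩
  have haN : a' ∈ G.neighborFinset u := by simpa using hau.symm
  have hbN : b ∈ G.neighborFinset u := by simpa using hub
  have ha'H : a' ∉ H := fun h => hH.notMem a' h (by simp [hAB, hA.last_mem])
  have hbH : b ∉ H := fun h => hH.notMem b h hbP
  have ha'b : a' ≠ b := by
    have := hA.last_mem
    have := hB.head_mem
    simp only [List.nodup_append, List.nodup_cons, List.mem_cons] at hnd
    grind
  have hsub : ∀ h ∈ H, G.neighborFinset h ⊆ insert u (H.erase h) := by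
    intro h hh w hw
    have hw : G.Adj h w := by simpa using hw
    rcases hnbr h hh w hw with h' | rfl
    · simp [h', hw.ne.symm]
    · simp
  have hle : ∀ h ∈ H, d ≤ H.card := by
    intro h hh
    have h₁ := Finset.card_le_card (hsub h hh)
    rw [card_neighborFinset_eq_degree] at h₁
    have h₂ := Finset.card_insert_le u (H.erase h)
    rw [Finset.card_erase_of_mem hh] at h₂
    have := Finset.card_pos.2 ⟨h, hh⟩
    have := hd h
    omega
  have hone : 1 ≤ d := by
    have h₁ : ({z, a', b} : Finset V) ⊆ G.neighborFinset u := by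
      intro x hx
      simp only [Finset.mem_insert, Finset.mem_singleton] at hx
      rcases hx with rfl | rfl | rfl
      · simpa using hu.symm
      · exact haN
      · exact hbN
    have h₂ := Finset.card_le_card h₁
    rw [card_neighborFinset_eq_degree, Finset.card_eq_three.2
      ⟨z, a', b, fun h => ha'H (h ▸ hz), fun h => hbH (h ▸ hz), ha'b, rfl⟩] at h₂
    have := hd' u
    omega
  -- Otherwise `u` has all of `H` and its two path neighbours as neighbours, at least `d + 2` in
  -- all.
  have hex : ∃ z ∈ H, ¬ G.Adj z u := by
    by_contra! hcon
    have h₁ : insert a' (insert b H) ⊆ G.neighborFinset u := by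
      intro x hx
      simp only [Finset.mem_insert] at hx
      rcases hx with rfl | rfl | hx
      · exact haN
      · exact hbN
      · simpa using (hcon x hx).symm
    have h₂ := Finset.card_le_card h₁
    rw [card_neighborFinset_eq_degree, Finset.card_insert_of_notMem (by simp [ha'b, ha'H]),
      Finset.card_insert_of_notMem hbH] at h₂
    have := hd' u
    have := hle z hz
    omega
  -- A vertex of `H` not adjacent to `u` has degree `|H| - 1`, which is at least `d`; one adjacent
  -- to `u` has degree `|H|`, which is at most `d + 1`.
  have hcard : H.card = d + 1 := by
    obtain ⟨y, hy, hyu⟩ := hex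
    have h₁ : G.neighborFinset y ⊆ H.erase y := by
      intro w hw
      have hw : G.Adj y w := by simpa using hw
      rcases hnbr y hy w hw with h' | rfl
      · simp [h', hw.ne.symm]
      · exact (hyu hw).elim
    have h₂ := Finset.card_le_card h₁
    rw [card_neighborFinset_eq_degree, Finset.card_erase_of_mem hy] at h₂
    have h₃ : insert u (H.erase z) ⊆ G.neighborFinset z := by
      intro x hx
      simp only [Finset.mem_insert, Finset.mem_erase] at hx
      rcases hx with rfl | ⟨hxz, hx⟩
      · simpa using hu
      · simpa using hHK hz hx hxz.symm
    have h₄ := Finset.card_le_card h₃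
    rw [card_neighborFinset_eq_degree, Finset.card_insert_of_notMem (by simp [huH]),
      Finset.card_erase_of_mem hz] at h₄
    have := Finset.card_pos.2 ⟨y, hy⟩
    have := hd y
    have := hd' z
    omega
  obtain ⟨L, l, hL, hLnd, hLH⟩ := exists_route_of_isClique_of_mem hHK hz
  have hLlen : L.length = d + 1 := (length_eq_card_of_mem_iff hLnd hLH).trans hcard
  have hleA : d + 1 ≤ A.length := by
    have := hP.length_le_of_count_le (L := L) (Q := L.reverse ++ u :: B) hLnd
      (fun x hx => hH.notMem x ((hLH x).1 hx)) (hL.reverse.append hu (hB.cons hub)).isChain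
      (fun x => by simp [hAB, List.count_cons]; omega)
    simp only [hAB, List.length_append, List.length_cons, List.length_reverse] at this
    omega
  have hleB : d + 1 ≤ B.length := by
    have := hP.length_le_of_count_le (L := L) (Q := A ++ ([u] ++ L)) hLnd
      (fun x hx => hH.notMem x ((hLH x).1 hx))
      (hA.append hau ((IsRoute.singleton u).append hu.symm hL)).isChain
      (fun x => by simp [hAB, List.count_cons]; omega)
    simp only [hAB, List.length_append, List.length_cons, List.length_nil] at this
    omega
  -- A vertex missed by `H`, `N[a]` and `N[b]` would be independent of `y`, `a`, `b`, where `y` is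
  -- chosen in `H` not adjacent to `u`.
  have hcov : Fintype.card V ≤ 3 * d + 5 := by
    obtain ⟨y, hy, hyu⟩ := hex
    have h₁ : (Finset.univ : Finset V) ⊆
        H ∪ (insert a (G.neighborFinset a) ∪ insert b (G.neighborFinset b)) := by
      intro x _
      by_contra hx
      simp only [Finset.mem_union, Finset.mem_insert, mem_neighborFinset, not_or] at hx
      obtain ⟨hxH, ⟨hxa, hxa'⟩, hxb, hxb'⟩ := hx
      have := length_le_indepNum (G := G) [y, a, b, x] (by
        simp only [List.pairwise_cons, List.mem_cons, List.not_mem_nil, or_false,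
          forall_eq_or_imp, forall_eq, IsEmpty.forall_iff, implies_true, List.Pairwise.nil,
          and_true]
        refine ⟨⟨hna y hy, hnb y hy, fun h => hxH (h ▸ hy), fun h => ?_⟩, ⟨⟨hane, hab⟩,
          fun h => hxa h.symm, hxa'⟩, fun h => hxb h.symm, hxb'⟩
        exact (hnbr y hy x h).elim hxH fun hxu => hyu (hxu ▸ h))
      simp at this
      omega
    have h₂ := Finset.card_le_card h₁
    have h₃ := Finset.card_union_le H
      (insert a (G.neighborFinset a) ∪ insert b (G.neighborFinset b))
    have h₄ := Finset.card_union_le (insert a (G.neighborFinset a)) (insert b (G.neighborFinset b))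
    have h₅ := Finset.card_insert_le a (G.neighborFinset a)
    have h₆ := Finset.card_insert_le b (G.neighborFinset b)
    rw [card_neighborFinset_eq_degree] at h₅ h₆
    rw [Finset.card_univ] at h₂
    have := hd' a
    have := hd' b
    omega
  refine ⟨A, u, B, hAB, hAB ▸ hP, hAB ▸ hH, hHK, hcard, hnbr, ⟨z, hz, hu⟩, hex, hone, hleA, hleB,
    ?_⟩
  have := hH.card_add_length_le hP.nodup
  simp only [hAB, List.length_append, List.length_cons] at this
  omega

/-- If the lengths agreed, `H` could replace `A` in the longest path, and the last vertex `a'` of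
`A` would lie in a new gap. -/
theorem IsPendantGap.length_ne [DecidableRel G.Adj] (hG : G.Connected) (hα : G.indepNum ≤ 3)
    {d : ℕ} (hd : ∀ v, d ≤ G.degree v) (hd' : ∀ v, G.degree v ≤ d + 1) {A B : List V} {u : V}
    (h : G.IsPendantGap d H A u B) : A.length ≠ d + 1 := by
  intro hAlen
  obtain ⟨z, hz, hzu⟩ := h.exists_adj
  have hA : A ≠ [] := by
    rintro rfl
    simp at hAlen
  have hB : B ≠ [] := by
    have := h.le_right
    rintro rfl
    simp at this
  obtain ⟨a, a', b, b', hA, hau, hub, hB⟩ := IsRoute.exists_of_split h.longest.isChain hA hB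
  obtain ⟨L, l, hL, hLnd, hLH⟩ := exists_route_of_isClique_of_mem h.isClique hz
  have hLlen : L.length = d + 1 := (length_eq_card_of_mem_iff hLnd hLH).trans h.card_eq
  have hP' : G.IsLongest (L.reverse ++ u :: B) :=
    h.longest.of_count_le (L := L) hLnd
      (fun x hx => h.gap.notMem x ((hLH x).1 hx)) (hL.reverse.append hzu (hB.cons hub)).isChain
      (fun x => by simp [List.count_cons]; omega) (by simp [hLlen, hAlen])
  have hnd := h.longest.nodup
  have ha' : a' ∉ L.reverse ++ u :: B := by
    have h₁ : a' ∉ L := fun hx =>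
      h.gap.notMem a' ((hLH a').1 hx) (by simp [hA.last_mem])
    have := hA.last_mem
    simp only [List.nodup_append, List.nodup_cons, List.mem_cons] at hnd
    simp only [List.mem_append, List.mem_reverse, List.mem_cons, not_or]
    grind
  obtain ⟨H', ha'H, hH'⟩ := exists_isGap G ha'
  obtain ⟨A₁, v, B₁, hAB, hv⟩ := hH'.exists_isPendantGap hG hα hd hd' hP'
  have huH : u ∉ H := fun hu => h.gap.notMem u hu (by simp)
  have huH' : u ∉ H' := fun hu => hH'.notMem u hu (by simp)
  -- The new gap contains `a'`, whose neighbour `u` is on the new path, so it hangs at `u` as well.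
  obtain rfl : u = v := (hv.nbr a' ha'H u hau).resolve_left huH'
  obtain ⟨y, hy, hyu⟩ := h.exists_not_adj
  obtain ⟨y', hy', hyu'⟩ := hv.exists_not_adj
  have hyH' : y ∉ H' := fun hx => hH'.notMem y hx (by simp [hLH, hy])
  have hy'H : y' ∉ H := fun hx => hH'.notMem y' hy' (by simp [hLH, hx])
  -- Vertices `y`, `y'` of the two gaps not adjacent to `u`, with `u` and a non-neighbour `w` of `u`
  -- in `B`, would be independent.
  have hall : ∀ w ∈ B, G.Adj u w := by
    intro w hw
    by_contra hwu
    have hwH : w ∉ H := fun hx => h.gap.notMem w hx (by simp [hw])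
    have hwH' : w ∉ H' := fun hx => hH'.notMem w hx (by simp [hw])
    have hwne : u ≠ w := by
      rintro rfl
      simp only [List.nodup_append, List.nodup_cons] at hnd
      exact hnd.2.1.1 hw
    have := length_le_indepNum (G := G) [y, y', u, w] (by
      simp only [List.pairwise_cons, List.mem_cons, List.not_mem_nil, or_false,
        forall_eq_or_imp, forall_eq, IsEmpty.forall_iff, implies_true, List.Pairwise.nil,
        and_true]
      refine ⟨⟨⟨fun hx => hyH' (hx ▸ hy'), fun hx => ?_⟩, ⟨fun hx => huH (hx ▸ hy), hyu⟩,
        fun hx => hwH (hx ▸ hy), fun hx => ?_⟩, ⟨⟨fun hx => huH' (hx ▸ hy'), hyu'⟩,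
        fun hx => hwH' (hx ▸ hy'), fun hx => ?_⟩, hwne, hwu⟩
      · exact (h.nbr y hy y' hx).elim hy'H fun hx => huH' (hx ▸ hy')
      · exact (h.nbr y hy w hx).elim hwH fun hx => hwne hx.symm
      · exact (hv.nbr y' hy' w hx).elim hwH' fun hx => hwne hx.symm)
    simp at this
    omega
  have hsub : insert z B.toFinset ⊆ G.neighborFinset u := by
    intro x hx
    simp only [Finset.mem_insert, List.mem_toFinset] at hx
    rcases hx with rfl | hx
    · simpa using hzu.symm
    · simpa using hall x hx
  -- This gives `u` at least `d + 3` neighbours.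
  have hsub' : insert a' (insert z B.toFinset) ⊆ G.neighborFinset u := by
    refine Finset.insert_subset ?_ hsub
    simpa using hau.symm
  have hcard := Finset.card_le_card hsub'
  have hBnd : B.Nodup := (List.nodup_cons.1 (List.nodup_append.1 hnd).2.1).2
  rw [card_neighborFinset_eq_degree, Finset.card_insert_of_notMem, Finset.card_insert_of_notMem,
    List.toFinset_card_of_nodup hBnd] at hcard
  · have := hd' u
    have := h.le_right
    omega
  · intro hx
    exact h.gap.notMem z hz (by simp [List.mem_toFinset.1 hx])
  · intro hx
    refine ha' ?_
    rcases Finset.mem_insert.1 hx with rfl | hx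
    · simp [hLH, hz]
    · simp [List.mem_toFinset.1 hx]

theorem hasSpanningPath_of_indepNum_le_three [DecidableRel G.Adj] (hG : G.Connected)
    (hα : G.indepNum ≤ 3) (hΔ : G.maxDegree ≤ G.minDegree + 1) : G.HasSpanningPath := by
  have := hG.nonempty
  obtain ⟨P, hP⟩ := exists_isLongest G
  by_cases hall : ∀ x, x ∈ P
  · exact hasSpanningPath_of_list hP.nodup hP.isChain hall
  push Not at hall
  obtain ⟨z, hz⟩ := hall
  obtain ⟨H, -, hH⟩ := exists_isGap G hz
  have hd : ∀ v, G.minDegree ≤ G.degree v := G.minDegree_le_degree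
  have hd' : ∀ v, G.degree v ≤ G.minDegree + 1 := fun v => (G.degree_le_maxDegree v).trans hΔ
  obtain ⟨A, u, B, -, h⟩ := hH.exists_isPendantGap hG hα hd hd' hP
  -- Both sides now have at least `d + 2` vertices, against a total of at most `2d + 3`.
  have h₁ := h.length_ne hG hα hd hd'
  have h₂ := h.reverse.length_ne hG hα hd hd'
  have := h.le_left
  have := h.le_right
  have := h.le_add
  rw [List.length_reverse] at h₂
  omega

end

/-! ### 2-connected regular graphs with `α ≤ 4` -/

section

variable {V : Type*} {G : SimpleGraph V} {P : List V} {H : Finset V}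

theorem IsKVertexConnected.connected [Fintype V] {k : ℕ} (hG : G.IsKVertexConnected k)
    (hk : 0 < k) : G.Connected := by
  have h := hG.2 ∅ (by simpa using hk)
  have := h.nonempty.map Subtype.val
  refine ⟨fun x y => ?_⟩
  exact (h.preconnected ⟨x, by simp⟩ ⟨y, by simp⟩).map (Embedding.induce _).toHom

/-- If `H` were attached at `u` alone, it would be closed under adjacency in `G - u` and so cut off
from `x`. -/
theorem IsGap.exists_adj_ne [Fintype V] (hG : G.IsKVertexConnected 2) (hH : G.IsGap P H) {u x : V}
    (hu : u ∈ P) (hx : x ∈ P) (hxu : x ≠ u) : ∃ h ∈ H, ∃ v ∈ P, v ≠ u ∧ G.Adj h v := by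
  by_contra! hcon
  obtain ⟨h, hh⟩ := hH.nonempty
  have hhu : h ≠ u := fun e => hH.notMem h hh (e ▸ hu)
  have hc := hG.2 {u} (by simp)
  have hxH : (⟨x, by simpa using hxu⟩ : (((({u} : Finset V) : Set V)ᶜ : Set V))) ∈
      {a : (((({u} : Finset V) : Set V)ᶜ : Set V)) | a.1 ∈ H} :=
    mem_of_reachable_of_closed _
      (fun a ha b hab => (hH.closed a.1 ha b.1 hab).elim id fun hb =>
        (hcon a.1 ha b.1 hb (by simpa using b.2) hab).elim)
      (show (⟨h, by simpa using hhu⟩ : (((({u} : Finset V) : Set V)ᶜ : Set V))) ∈ _ from hh)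
      (hc.preconnected _ _)
  exact hH.notMem x hxH hx

/-- A clique component `H` of the complement of the longest path `A ++ u :: (B ++ v :: C)`,
with `d` vertices, attached to `u` and `v`. -/
structure IsTwinGap [Fintype V] (G : SimpleGraph V) (d : ℕ) (H : Finset V) (A : List V) (u : V)
    (B : List V) (v : V) (C : List V) : Prop where
  longest : G.IsLongest (A ++ u :: (B ++ v :: C))
  gap : G.IsGap (A ++ u :: (B ++ v :: C)) H
  isClique : G.IsClique (H : Set V)
  card_eq : H.card = d
  nbr : ∀ h ∈ H, ∀ w, G.Adj h w → w ∈ H ∨ w = u ∨ w = v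
  adj_or_adj : ∀ h ∈ H, G.Adj h u ∨ G.Adj h v
  exists_adj : ∃ y ∈ H, ∃ z ∈ H, y ≠ z ∧ G.Adj y u ∧ G.Adj z v
  two_le : 2 ≤ d
  le_left : d ≤ A.length
  le_mid : d ≤ B.length
  le_right : d ≤ C.length
  le_add : A.length + B.length + C.length ≤ 3 * d + 1
  card_le : Fintype.card V ≤ 4 * d + 3

theorem IsGap.exists_split [Fintype V] (hG : G.IsKVertexConnected 2) (hP : G.IsLongest P)
    (hH : G.IsGap P H) : ∃ A u B v C, P = A ++ u :: (B ++ v :: C) ∧ (∃ y ∈ H, G.Adj y u) ∧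
      ∃ z ∈ H, G.Adj z v := by
  classical
  obtain ⟨y, hy, u, huP, hu⟩ := hH.exists_adj (hG.connected two_pos)
    (hP.ne_nil (hH.notMem _ hH.nonempty.choose_spec))
  obtain ⟨A, B, hAB⟩ := List.append_of_mem huP
  obtain ⟨hA, -⟩ := hP.ne_nil_of_adj (hH.notMem y hy) hAB hu
  obtain ⟨x, hx⟩ := List.exists_mem_of_ne_nil A hA
  have hnd := hP.nodup
  have hxu : x ≠ u := by
    rintro rfl
    rw [hAB] at hnd
    exact (List.nodup_append.1 hnd).2.2 x hx x (by simp) rfl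
  obtain ⟨z, hz, v, hvP, hvu, hv⟩ := hH.exists_adj_ne hG huP (by simp [hAB, hx]) hxu
  have : v ∈ A ∨ v ∈ B := by
    rw [hAB] at hvP
    simpa [hvu] using hvP
  rcases this with hv' | hv'
  · obtain ⟨A₁, A₂, rfl⟩ := List.append_of_mem hv'
    exact ⟨A₁, v, A₂, u, B, by simpa using hAB, ⟨z, hz, hv⟩, y, hy, hu⟩
  · obtain ⟨B₁, B₂, rfl⟩ := List.append_of_mem hv'
    exact ⟨A, u, B₁, v, B₂, hAB, ⟨y, hy, hu⟩, z, hz, hv⟩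

variable [Fintype V] [DecidableEq V]

/-- A gap with three neighbours on a longest path yields an independent set of five vertices,
consisting of one vertex of the gap, the head of the path and three successors. -/
theorem IsGap.five_le_indepNum (hH : G.IsGap P H) (hP : G.IsLongest P) {A B C D : List V}
    {u v w x y z : V} (hABC : P = A ++ u :: (B ++ v :: (C ++ w :: D))) (hx : x ∈ H)
    (hu : G.Adj x u) (hy : y ∈ H) (hv : G.Adj y v) (hz : z ∈ H) (hw : G.Adj z w) :
    5 ≤ G.indepNum := by
  have hABC₂ : P = (A ++ u :: B) ++ v :: (C ++ w :: D) := by simp [hABC]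
  have hABC₃ : P = (A ++ u :: (B ++ v :: C)) ++ w :: D := by simp [hABC]
  have hABC₄ : P = A ++ u :: ((B ++ v :: C) ++ w :: D) := by simp [hABC]
  have hA := (hP.ne_nil_of_adj (hH.notMem x hx) hABC hu).1
  have hB := hH.ne_nil_of_adj hP hABC hx hu hy hv
  have hC := hH.ne_nil_of_adj hP hABC₂ hy hv hz hw
  have hD := (hP.ne_nil_of_adj (hH.notMem z hz) hABC₃ hw).2
  have hchain := hP.isChain
  rw [hABC] at hchain
  obtain ⟨a, a', b, e', hA, hau, hub, hBCD⟩ := IsRoute.exists_of_split hchain hA (by simp)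
  obtain ⟨b₁, b', c, e₁, hB, hbv, hvc, hCD⟩ := IsRoute.exists_of_split hBCD.isChain hB (by simp)
  obtain ⟨c₁, c', e, e₂, hC, hcw, hwe, hD⟩ := IsRoute.exists_of_split hCD.isChain hC hD
  obtain rfl : b = b₁ := by
    have := hBCD.head
    rw [List.head?_append, hB.head] at this
    simpa using this.symm
  obtain rfl : c = c₁ := by
    have := hCD.head
    rw [List.head?_append, hC.head] at this
    simpa using this.symm
  have hAB := hA.append hau (hB.cons hub)
  have hBC := hB.append hbv (hC.cons hvc)
  have hABC' := hA.append hau (hBC.cons hub)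
  have hnd := hP.nodup
  have haP : a ∈ P := by simp [hABC, hA.head_mem]
  have hbP : b ∈ P := by simp [hABC, hB.head_mem]
  have hcP : c ∈ P := by simp [hABC, hC.head_mem]
  have heP : e ∈ P := by simp [hABC, hD.head_mem]
  have hne : a ≠ b ∧ a ≠ c ∧ a ≠ e ∧ b ≠ c ∧ b ≠ e ∧ c ≠ e := by
    rw [hABC] at hnd
    have := hA.head_mem
    have := hB.head_mem
    have := hC.head_mem
    have := hD.head_mem
    simp only [List.nodup_append, List.nodup_cons, List.mem_append, List.mem_cons] at hnd
    grind
  obtain ⟨hab, hac, hae, hbc, hbe, hce⟩ := hne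
  refine length_le_indepNum [x, a, b, c, e] ?_
  simp only [List.pairwise_cons, List.mem_cons, List.not_mem_nil, or_false, forall_eq_or_imp,
    forall_eq, IsEmpty.forall_iff, implies_true, List.Pairwise.nil, and_true]
  have hPr : G.IsRoute P a e₂ := hABC₃ ▸ hABC'.append hcw (hD.cons hwe)
  exact ⟨⟨⟨hH.ne_of_mem hx haP, hP.not_adj_head (hH.notMem x hx) hPr⟩,
    ⟨hH.ne_of_mem hx hbP, hH.not_adj_succ hP hABC hx hu hBCD hx⟩,
    ⟨hH.ne_of_mem hx hcP, hH.not_adj_succ hP hABC₂ hy hv hCD hx⟩,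
    ⟨hH.ne_of_mem hx heP, hH.not_adj_succ hP hABC₃ hz hw hD hx⟩⟩,
    ⟨⟨hab, hP.not_adj_head_succ (hH.notMem x hx) hABC hu hA hau hBCD⟩,
    ⟨hac, hP.not_adj_head_succ (hH.notMem y hy) hABC₂ hv hAB hbv hCD⟩,
    ⟨hae, hP.not_adj_head_succ (hH.notMem z hz) hABC₃ hw hABC' hcw hD⟩⟩,
    ⟨⟨hbc, hH.not_adj_succ_succ hP hABC hx hu hy hv hA hau hB hbv hCD⟩,
    ⟨hbe, hH.not_adj_succ_succ hP hABC₄ hx hu hz hw hA hau hBC hcw hD⟩⟩,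
    ⟨hce, hH.not_adj_succ_succ hP hABC₂ hy hv hz hw hAB hbv hC hcw hD⟩⟩

theorem IsGap.exists_isTwinGap [DecidableRel G.Adj] (hG : G.IsKVertexConnected 2)
    (hα : G.indepNum ≤ 4) {d : ℕ} (hd : ∀ v, G.degree v = d) (hP : G.IsLongest P)
    (hH : G.IsGap P H) :
    ∃ A u B v C, P = A ++ u :: (B ++ v :: C) ∧ G.IsTwinGap d H A u B v C := by
  obtain ⟨A, u, B, v, C, hABC, ⟨y, hy, hu⟩, z, hz, hv⟩ := hH.exists_split hG hP
  have huP : u ∈ P := by simp [hABC]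
  have hvP : v ∈ P := by simp [hABC]
  have huH : u ∉ H := fun h => hH.notMem u h huP
  have hvH : v ∉ H := fun h => hH.notMem v h hvP
  have hABC₂ : P = (A ++ u :: B) ++ v :: C := by simp [hABC]
  have hA := (hP.ne_nil_of_adj (hH.notMem y hy) hABC hu).1
  have hB := hH.ne_nil_of_adj hP hABC hy hu hz hv
  have hC := (hP.ne_nil_of_adj (hH.notMem z hz) hABC₂ hv).2
  have hchain := hP.isChain
  rw [hABC] at hchain
  obtain ⟨a, a', b, c', hA, hau, hub, hBC⟩ := IsRoute.exists_of_split hchain hA (by simp)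
  obtain ⟨b₁, b', c, c₁, hB, hbv, hvc, hC⟩ := IsRoute.exists_of_split hBC.isChain hB hC
  obtain rfl : b = b₁ := by
    have := hBC.head
    rw [List.head?_append, hB.head] at this
    simpa using this.symm
  have hAB := hA.append hau (hB.cons hub)
  have hPr : G.IsRoute P a c₁ := hABC₂ ▸ hAB.append hbv (hC.cons hvc)
  have haP : a ∈ P := by simp [hABC, hA.head_mem]
  have ha'P : a' ∈ P := by simp [hABC, hA.last_mem]
  have hbP : b ∈ P := by simp [hABC, hB.head_mem]
  have hcP : c ∈ P := by simp [hABC, hC.head_mem]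
  have hnd := hP.nodup
  rw [hABC] at hnd
  have hne : a ≠ b ∧ a ≠ c ∧ b ≠ c ∧ u ≠ v ∧ a' ≠ b := by
    have := hA.head_mem
    have := hA.last_mem
    have := hB.head_mem
    have := hC.head_mem
    simp only [List.nodup_append, List.nodup_cons, List.mem_append, List.mem_cons] at hnd
    grind
  obtain ⟨habne, hacne, hbcne, huv, ha'b⟩ := hne
  have hab := hP.not_adj_head_succ (hH.notMem y hy) hABC hu hA hau hBC
  have hac := hP.not_adj_head_succ (hH.notMem z hz) hABC₂ hv hAB hbv hC
  have hbc := hH.not_adj_succ_succ hP hABC hy hu hz hv hA hau hB hbv hC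
  have hna : ∀ h ∈ H, h ≠ a ∧ ¬ G.Adj h a := fun h hh =>
    ⟨hH.ne_of_mem hh haP, hP.not_adj_head (hH.notMem h hh) hPr⟩
  have hnb : ∀ h ∈ H, h ≠ b ∧ ¬ G.Adj h b := fun h hh =>
    ⟨hH.ne_of_mem hh hbP, hH.not_adj_succ hP hABC hy hu hBC hh⟩
  have hnc : ∀ h ∈ H, h ≠ c ∧ ¬ G.Adj h c := fun h hh =>
    ⟨hH.ne_of_mem hh hcP, hH.not_adj_succ hP hABC₂ hz hv hC hh⟩
  have hnbr : ∀ h ∈ H, ∀ w, G.Adj h w → w ∈ H ∨ w = u ∨ w = v := by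
    intro h hh w hw
    rcases hH.closed h hh w hw with hwH | hwP
    · exact Or.inl hwH
    right
    by_contra! hwuv
    have : w ∈ A ∨ w ∈ B ∨ w ∈ C := by
      rw [hABC] at hwP
      simpa [hwuv] using hwP
    rcases this with hw' | hw' | hw'
    · obtain ⟨A₁, A₂, rfl⟩ := List.append_of_mem hw'
      have := hH.five_le_indepNum hP (A := A₁) (B := A₂) (C := B) (D := C)
        (by simpa using hABC) hh hw hy hu hz hv
      omega
    · obtain ⟨B₁, B₂, rfl⟩ := List.append_of_mem hw'
      have := hH.five_le_indepNum hP (A := A) (B := B₁) (C := B₂) (D := C)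
        (by simpa using hABC) hy hu hh hw hz hv
      omega
    · obtain ⟨C₁, C₂, rfl⟩ := List.append_of_mem hw'
      have := hH.five_le_indepNum hP hABC hy hu hz hv hh hw
      omega
  have hHK : G.IsClique (H : Set V) := by
    intro h hh h' hh' hne
    by_contra hadj
    have := length_le_indepNum (G := G) [h, h', a, b, c] (by
      simp only [List.pairwise_cons, List.mem_cons, List.not_mem_nil, or_false, forall_eq_or_imp,
        forall_eq, IsEmpty.forall_iff, implies_true, List.Pairwise.nil, and_true]
      exact ⟨⟨⟨hne, hadj⟩, hna h hh, hnb h hh, hnc h hh⟩, ⟨hna h' hh', hnb h' hh', hnc h' hh'⟩,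
        ⟨⟨habne, hab⟩, hacne, hac⟩, hbcne, hbc⟩)
    simp at this
    omega
  have haN : a' ∈ G.neighborFinset u := by simpa using hau.symm
  have hbN : b ∈ G.neighborFinset u := by simpa using hub
  have ha'H : a' ∉ H := fun h => hH.notMem a' h ha'P
  have hbH : b ∉ H := fun h => hH.notMem b h hbP
  have hsub : ∀ h ∈ H, G.neighborFinset h ⊆ insert u (insert v (H.erase h)) := by
    intro h hh w hw
    have hw : G.Adj h w := by simpa using hw
    rcases hnbr h hh w hw with h' | rfl | rfl
    · simp [h', hw.ne.symm]
    · simp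
    · simp
  have hins : ∀ h ∈ H, (insert u (insert v (H.erase h))).card = H.card + 1 := by
    intro h hh
    rw [Finset.card_insert_of_notMem (by simp [huv, huH]),
      Finset.card_insert_of_notMem (by simp [hvH]), Finset.card_erase_of_mem hh]
    have := Finset.card_pos.2 ⟨h, hh⟩
    omega
  have hHle : H.card ≤ d := by
    have h₃ : insert u (H.erase y) ⊆ G.neighborFinset y := by
      intro x hx
      simp only [Finset.mem_insert, Finset.mem_erase] at hx
      rcases hx with rfl | ⟨hxy, hx⟩
      · simpa using hu
      · simpa using hHK hy hx hxy.symm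
    have h₄ := Finset.card_le_card h₃
    rw [card_neighborFinset_eq_degree, Finset.card_insert_of_notMem (by simp [huH]),
      Finset.card_erase_of_mem hy, hd] at h₄
    have := Finset.card_pos.2 ⟨y, hy⟩
    omega
  have hled : d ≤ H.card + 1 := by
    have h₁ := Finset.card_le_card (hsub y hy)
    rwa [card_neighborFinset_eq_degree, hd, hins y hy] at h₁
  have htwo : 2 ≤ d := by
    have h₁ : ({a', b} : Finset V) ⊆ G.neighborFinset u := by
      intro x hx
      simp only [Finset.mem_insert, Finset.mem_singleton] at hx
      rcases hx with rfl | rfl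
      · exact haN
      · exact hbN
    have h₂ := Finset.card_le_card h₁
    rwa [card_neighborFinset_eq_degree, Finset.card_pair ha'b, hd] at h₂
  -- If `|H| = d - 1`, every vertex of `H` needs both `u` and `v` to reach degree `d`, and `u` gets
  -- `d + 1` neighbours.
  have hcard : H.card = d := by
    by_contra hHd
    have hall : ∀ h ∈ H, G.Adj u h := by
      intro h hh
      have := Finset.eq_of_subset_of_card_le (hsub h hh) (by
        rw [card_neighborFinset_eq_degree, hd, hins h hh]
        omega)
      have hu : u ∈ G.neighborFinset h := this ▸ by simp
      exact ((G.mem_neighborFinset h u).1 hu).symm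
    have h₁ : insert a' (insert b H) ⊆ G.neighborFinset u := by
      intro x hx
      simp only [Finset.mem_insert] at hx
      rcases hx with rfl | rfl | hx
      · exact haN
      · exact hbN
      · simpa using hall x hx
    have h₂ := Finset.card_le_card h₁
    rw [card_neighborFinset_eq_degree, Finset.card_insert_of_notMem (by simp [ha'b, ha'H]),
      Finset.card_insert_of_notMem hbH, hd] at h₂
    omega
  have hor : ∀ h ∈ H, G.Adj h u ∨ G.Adj h v := by
    intro h hh
    by_contra! hcon
    have h₁ : G.neighborFinset h ⊆ H.erase h := by
      intro w hw
      have hw : G.Adj h w := by simpa using hw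
      rcases hnbr h hh w hw with h' | rfl | rfl
      · simp [h', hw.ne.symm]
      · exact (hcon.1 hw).elim
      · exact (hcon.2 hw).elim
    have h₂ := Finset.card_le_card h₁
    rw [card_neighborFinset_eq_degree, Finset.card_erase_of_mem hh, hd] at h₂
    omega
  -- A vertex attached to both `u` and `v` would have degree `|H| + 1 = d + 1`.
  have hyz : y ≠ z := by
    rintro rfl
    have h₁ : insert u (insert v (H.erase y)) ⊆ G.neighborFinset y := by
      intro x hx
      simp only [Finset.mem_insert, Finset.mem_erase] at hx
      rcases hx with rfl | rfl | ⟨hxy, hx⟩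
      · simpa using hu
      · simpa using hv
      · simpa using hHK hy hx hxy.symm
    have h₂ := Finset.card_le_card h₁
    rw [card_neighborFinset_eq_degree, hd, hins y hy] at h₂
    omega
  obtain ⟨L, hL, hLnd, hLH⟩ := exists_route_of_isClique _ H y z rfl hHK hy hz hyz
  have hLlen : L.length = d := (length_eq_card_of_mem_iff hLnd hLH).trans hcard
  have hLP : ∀ x ∈ L, x ∉ P := fun x hx => hH.notMem x ((hLH x).1 hx)
  have hleA : d ≤ A.length := by
    have := hP.length_le_of_count_le (L := L) (Q := L.reverse ++ u :: (B ++ v :: C)) hLnd hLP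
      (hL.reverse.append hu (hBC.cons hub)).isChain
      (fun x => by simp [hABC, List.count_cons]; omega)
    simp only [hABC, List.length_append, List.length_cons, List.length_reverse] at this
    omega
  have hleB : d ≤ B.length := by
    have := hP.length_le_of_count_le (L := L) (Q := A ++ ([u] ++ (L ++ v :: C))) hLnd hLP
      (hA.append hau ((IsRoute.singleton u).append hu.symm (hL.append hv (hC.cons hvc)))).isChain
      (fun x => by simp [hABC, List.count_cons]; omega)
    simp only [hABC, List.length_append, List.length_cons, List.length_nil] at this
    omega
  have hleC : d ≤ C.length := by
    have := hP.length_le_of_count_le (L := L) (Q := (A ++ u :: B) ++ ([v] ++ L.reverse)) hLnd hLP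
      (hAB.append hbv ((IsRoute.singleton v).append hv.symm hL.reverse)).isChain
      (fun x => by simp [hABC, List.count_cons]; omega)
    simp only [hABC, List.length_append, List.length_cons, List.length_nil,
      List.length_reverse] at this
    omega
  -- The neighbour `u` of `b` and the neighbour `v` of `c` are counted once, with `H`; this saving
  -- of two yields the total `3d + 1` for the segments.
  have hcov : Fintype.card V ≤ 4 * d + 3 := by
    have h₁ : (Finset.univ : Finset V) ⊆
        (H ∪ {u, v}) ∪ (insert a (G.neighborFinset a) ∪
          (insert b ((G.neighborFinset b).erase u) ∪ insert c ((G.neighborFinset c).erase v))) := by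
      intro x _
      by_contra hx
      simp only [Finset.mem_union, Finset.mem_insert, Finset.mem_singleton, Finset.mem_erase,
        mem_neighborFinset, not_or, not_and] at hx
      obtain ⟨⟨hxH, hxu, hxv⟩, ⟨hxa, hxa'⟩, ⟨hxb, hxb'⟩, hxc, hxc'⟩ := hx
      have := length_le_indepNum (G := G) [y, a, b, c, x] (by
        simp only [List.pairwise_cons, List.mem_cons, List.not_mem_nil, or_false,
          forall_eq_or_imp, forall_eq, IsEmpty.forall_iff, implies_true, List.Pairwise.nil,
          and_true]
        refine ⟨⟨hna y hy, hnb y hy, hnc y hy, fun h => hxH (h ▸ hy), fun h => ?_⟩,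
          ⟨⟨habne, hab⟩, ⟨hacne, hac⟩, fun h => hxa h.symm, hxa'⟩,
          ⟨⟨hbcne, hbc⟩, fun h => hxb h.symm, hxb' hxu⟩, fun h => hxc h.symm, hxc' hxv⟩
        rcases hnbr y hy x h with h | h | h
        · exact hxH h
        · exact hxu h
        · exact hxv h)
      simp at this
      omega
    have h₂ := (Finset.card_le_card h₁).trans (Finset.card_union_le _ _)
    have h₃ := Finset.card_union_le H {u, v}
    have h₄ := Finset.card_union_le (insert a (G.neighborFinset a))
      (insert b ((G.neighborFinset b).erase u) ∪ insert c ((G.neighborFinset c).erase v))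
    have h₅ := Finset.card_union_le (insert b ((G.neighborFinset b).erase u))
      (insert c ((G.neighborFinset c).erase v))
    have h₆ := Finset.card_insert_le a (G.neighborFinset a)
    have h₇ := Finset.card_insert_le b ((G.neighborFinset b).erase u)
    have h₈ := Finset.card_insert_le c ((G.neighborFinset c).erase v)
    rw [card_neighborFinset_eq_degree, hd] at h₆
    rw [Finset.card_erase_of_mem (by simpa using hub.symm), card_neighborFinset_eq_degree,
      hd] at h₇
    rw [Finset.card_erase_of_mem (by simpa using hvc.symm), card_neighborFinset_eq_degree,
      hd] at h₈
    rw [Finset.card_pair huv] at h₃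
    rw [Finset.card_univ] at h₂
    omega
  refine ⟨A, u, B, v, C, hABC, hABC ▸ hP, hABC ▸ hH, hHK, hcard, hnbr, hor,
    ⟨y, hy, z, hz, hyz, hu, hv⟩, htwo, hleA, hleB, hleC, ?_, hcov⟩
  have := hH.card_add_length_le hP.nodup
  simp only [hABC, List.length_append, List.length_cons] at this
  omega

/-- A second gap would also have `d` vertices, making at least `5d + 2` in all, more than `4d + 3`
since `d ≥ 2`. -/
theorem IsTwinGap.mem_or_mem [DecidableRel G.Adj] (hG : G.IsKVertexConnected 2)
    (hα : G.indepNum ≤ 4) {d : ℕ} (hd : ∀ v, G.degree v = d) {A B C : List V} {u v : V}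
    (h : G.IsTwinGap d H A u B v C) (x : V) : x ∈ H ∨ x ∈ A ++ u :: (B ++ v :: C) := by
  by_contra! hx
  obtain ⟨H', hxH', hH'⟩ := exists_isGap G hx.2
  obtain ⟨_, _, _, _, _, -, h'⟩ := hH'.exists_isTwinGap hG hα hd h.longest
  have := h.gap.card_add_card_add_length_le hH'
    (h.gap.disjoint_of_isClique hH' h'.isClique hxH' hx.1) h.longest.nodup
  simp only [List.length_append, List.length_cons] at this
  have := h.card_eq
  have := h'.card_eq
  have := h.card_le
  have := h.two_le
  have := h.le_left
  have := h.le_mid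
  have := h.le_right
  omega

theorem false_of_adj_or_adj [DecidableRel G.Adj] {d : ℕ} (hd : ∀ v, G.degree v = d)
    {H' : Finset V} {u v t : V} (hdis : Disjoint H H') (hH : H.card = d) (hH' : H'.card = d)
    (hadj : ∀ x ∈ H, G.Adj x u ∨ G.Adj x v) (hadj' : ∀ x ∈ H', G.Adj x u ∨ G.Adj x v)
    (ht : t ∉ H) (ht' : t ∉ H') (htu : G.Adj t u) : False := by
  have h₁ : insert t (H ∪ H') ⊆ G.neighborFinset u ∪ G.neighborFinset v := by
    intro x hx
    simp only [Finset.mem_insert, Finset.mem_union] at hx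
    simp only [Finset.mem_union, mem_neighborFinset, G.adj_comm u, G.adj_comm v]
    rcases hx with rfl | hx | hx
    · exact Or.inl htu
    · exact hadj x hx
    · exact hadj' x hx
  have h₂ := (Finset.card_le_card h₁).trans (Finset.card_union_le _ _)
  rw [Finset.card_insert_of_notMem (by simp [ht, ht']), Finset.card_union_of_disjoint hdis,
    card_neighborFinset_eq_degree, card_neighborFinset_eq_degree, hd, hd] at h₂
  omega

theorem IsTwinGap.length_mid_ne [DecidableRel G.Adj] (hG : G.IsKVertexConnected 2)
    (hα : G.indepNum ≤ 4) {d : ℕ} (hd : ∀ v, G.degree v = d) {A B C : List V} {u v : V}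
    (h : G.IsTwinGap d H A u B v C) : B.length ≠ d := by
  intro hBlen
  obtain ⟨y, hy, z, hz, hyz, hu, hv⟩ := h.exists_adj
  have hpos := h.two_le
  have hA : A ≠ [] := List.ne_nil_of_length_pos (by have := h.le_left; omega)
  have hB : B ≠ [] := List.ne_nil_of_length_pos (by omega)
  have hC : C ≠ [] := List.ne_nil_of_length_pos (by have := h.le_right; omega)
  obtain ⟨a, a', b, c', hA, hau, hub, hBC⟩ :=
    IsRoute.exists_of_split h.longest.isChain hA (by simp)
  obtain ⟨b₁, b', c, c₁, hB, hbv, hvc, hC⟩ := IsRoute.exists_of_split hBC.isChain hB hC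
  obtain rfl : b = b₁ := by
    have := hBC.head
    rw [List.head?_append, hB.head] at this
    simpa using this.symm
  obtain ⟨L, hL, hLnd, hLH⟩ := exists_route_of_isClique _ H y z rfl h.isClique hy hz hyz
  have hLlen : L.length = d := (length_eq_card_of_mem_iff hLnd hLH).trans h.card_eq
  have hLP : ∀ x ∈ L, x ∉ A ++ u :: (B ++ v :: C) := fun x hx =>
    h.gap.notMem x ((hLH x).1 hx)
  have hP' : G.IsLongest (A ++ ([u] ++ (L ++ v :: C))) :=
    h.longest.of_count_le (L := L) hLnd hLP
      (hA.append hau ((IsRoute.singleton u).append hu.symm (hL.append hv (hC.cons hvc)))).isChain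
      (fun x => by simp [List.count_cons]; omega) (by simp [hLlen, hBlen])
  have hnd := h.longest.nodup
  have hBP' : ∀ x ∈ B, x ∉ A ++ ([u] ++ (L ++ v :: C)) := by
    intro x hx
    have h₁ : x ∉ L := fun hx' => hLP x hx' (by simp [hx])
    simp only [List.nodup_append, List.nodup_cons, List.mem_append, List.mem_cons] at hnd
    simp only [List.mem_append, List.mem_cons, List.not_mem_nil, or_false, not_or]
    grind
  have huv : u ≠ v := by
    rintro rfl
    simp [List.nodup_append] at hnd
  obtain ⟨H', hbH', hH'⟩ := exists_isGap G (hBP' b hB.head_mem)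
  obtain ⟨A₁, u₁, B₁, v₁, C₁, heq, h'⟩ := hH'.exists_isTwinGap hG hα hd hP'
  -- The new gap is the only one, so it contains both ends of `B`; their neighbours `u` and `v` are
  -- therefore its attachments.
  have hb'H' : b' ∈ H' := (h'.mem_or_mem hG hα hd b').resolve_right
    (heq ▸ hBP' b' hB.last_mem)
  have hu' := (h'.nbr b hbH' u hub.symm).resolve_left fun hx => hH'.notMem u hx (by simp)
  have hv' := (h'.nbr b' hb'H' v hbv).resolve_left fun hx => hH'.notMem v hx (by simp)
  have hadj' : ∀ x ∈ H', G.Adj x u ∨ G.Adj x v := by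
    intro x hx
    have := h'.adj_or_adj x hx
    rcases hu' with rfl | rfl <;> rcases hv' with rfl | rfl
    · exact (huv rfl).elim
    · exact this
    · exact this.symm
    · exact (huv rfl).elim
  refine false_of_adj_or_adj hd (t := a') ?_ h.card_eq h'.card_eq h.adj_or_adj hadj' ?_ ?_ hau
  · rw [Finset.disjoint_left]
    intro x hx hx'
    exact hH'.notMem x hx' (by simp [hLH, hx])
  · exact fun hx => h.gap.notMem a' hx (by simp [hA.last_mem])
  · exact fun hx => hH'.notMem a' hx (by simp [hA.last_mem])

theorem not_isTwinGap [DecidableRel G.Adj] (hG : G.IsKVertexConnected 2)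
    (hα : G.indepNum ≤ 4) {d : ℕ} (hd : ∀ v, G.degree v = d) {A B C : List V} {u v : V} :
    ¬ G.IsTwinGap d H A u B v C := by
  intro h
  obtain ⟨y, hy, z, hz, hyz, hu, hv⟩ := h.exists_adj
  have hBne := h.length_mid_ne hG hα hd
  have hpos := h.two_le
  have hAle := h.le_left
  have hBle := h.le_mid
  have hCle := h.le_right
  have hadd := h.le_add
  have hA : A ≠ [] := List.ne_nil_of_length_pos (by omega)
  obtain ⟨a, a', b, c', hA, hau, hub, hBC⟩ :=
    IsRoute.exists_of_split h.longest.isChain hA (by simp)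
  obtain ⟨L, hL, hLnd, hLH⟩ := exists_route_of_isClique _ H y z rfl h.isClique hy hz hyz
  have hLlen : L.length = d := (length_eq_card_of_mem_iff hLnd hLH).trans h.card_eq
  have hLP : ∀ x ∈ L, x ∉ A ++ u :: (B ++ v :: C) := fun x hx =>
    h.gap.notMem x ((hLH x).1 hx)
  -- As `|B| ≠ d`, the bounds force `|A| = |C| = d` and `|B| = d + 1`, so `H` can replace `A`.
  have hP' : G.IsLongest (L.reverse ++ u :: (B ++ v :: C)) :=
    h.longest.of_count_le (L := L) hLnd hLP (hL.reverse.append hu (hBC.cons hub)).isChain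
      (fun x => by simp [List.count_cons]; omega) (by simp [hLlen]; omega)
  have hnd := h.longest.nodup
  have ha' : a' ∉ L.reverse ++ u :: (B ++ v :: C) := by
    have h₁ : a' ∉ L := fun hx' => hLP a' hx' (by simp [hA.last_mem])
    have := (List.nodup_append.1 hnd).2.2 a' hA.last_mem
    simp only [List.mem_append, List.mem_reverse, not_or]
    exact ⟨h₁, fun hx => this a' (by simpa using hx) rfl⟩
  obtain ⟨H', ha'H', hH'⟩ := exists_isGap G ha'
  obtain ⟨A₁, u₁, B₁, v₁, C₁, heq, h'⟩ := hH'.exists_isTwinGap hG hα hd hP'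
  have hBne' := h'.length_mid_ne hG hα hd
  have hAle' := h'.le_left
  have hBle' := h'.le_mid
  have hCle' := h'.le_right
  have hadd' := h'.le_add
  -- The new decomposition obeys the same bounds, so its segments also have `d`, `d + 1`, `d`
  -- vertices; hence its attachments are again `u` and `v`.
  have hlenA : L.reverse.length = A₁.length := by
    have := congrArg List.length heq
    simp only [List.length_append, List.length_cons, List.length_reverse] at this ⊢
    omega
  obtain ⟨-, heq₁⟩ := List.append_inj heq hlenA
  obtain ⟨rfl, heq₂⟩ := List.cons.inj heq₁
  have hlenB : B.length = B₁.length := by omega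
  obtain ⟨-, heq₃⟩ := List.append_inj heq₂ hlenB
  obtain ⟨rfl, -⟩ := List.cons.inj heq₃
  have hbB : b ∈ B ++ v :: C := hBC.head_mem
  refine false_of_adj_or_adj hd (t := b) ?_ h.card_eq h'.card_eq h.adj_or_adj h'.adj_or_adj
    (fun hx => h.gap.notMem b hx ?_) (fun hx => hH'.notMem b hx ?_) hub.symm
  · rw [Finset.disjoint_left]
    intro x hx hx'
    exact hH'.notMem x hx' (by simp [hLH, hx])
  · exact List.mem_append_right _ (List.mem_cons_of_mem _ hbB)
  · exact List.mem_append_right _ (List.mem_cons_of_mem _ hbB)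

theorem hasSpanningPath_of_indepNum_le_four [DecidableRel G.Adj] (hG : G.IsKVertexConnected 2)
    (hα : G.indepNum ≤ 4) {d : ℕ} (hd : G.IsRegularOfDegree d) : G.HasSpanningPath := by
  have := (hG.connected two_pos).nonempty
  obtain ⟨P, hP⟩ := exists_isLongest G
  by_cases hall : ∀ x, x ∈ P
  · exact hasSpanningPath_of_list hP.nodup hP.isChain hall
  push Not at hall
  obtain ⟨z, hz⟩ := hall
  obtain ⟨H, -, hH⟩ := exists_isGap G hz
  obtain ⟨A, u, B, v, C, -, h⟩ := hH.exists_isTwinGap hG hα hd hP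
  exact (not_isTwinGap hG hα hd h).elim

end

end SimpleGraph

theorem corollary14 {V : Type*} [Fintype V] [DecidableEq V] (G : SimpleGraph V)
    [DecidableRel G.Adj] :
    (G.Connected → G.indepNum ≤ 3 → G.maxDegree ≤ G.minDegree + 1 → G.HasSpanningPath) ∧
    (G.IsKVertexConnected 2 → (∃ d : ℕ, G.IsRegularOfDegree d) → G.indepNum ≤ 4 →
      G.HasSpanningPath) := by
  refine ⟨G.hasSpanningPath_of_indepNum_le_three, ?_⟩
  rintro hG ⟨d, hd⟩ hα
  exact G.hasSpanningPath_of_indepNum_le_four hG hα hd
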